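/- Let $\mathfrak{g}$ be a finite-dimensional simple complex Lie algebra, let $\mathbb{K}=\mathbb{C}((\hbar))$ be the field of formal Laurent series, and let $\mathfrak{g}(\mathbb{K})=\mathfrak{g}\otimes_{\mathbb{C}}\mathbb{K}$, regarded as a Lie algebra over $\mathbb{K}$. Let $\bar\delta:\mathfrak{g}(\mathbb{K})\to\mathfrak{g}(\mathbb{K})\otimes_{\mathbb{K}}\mathfrak{g}(\mathbb{K})$ be an arbitrary Lie bialgebra structure on $\mathfrak{g}(\mathbb{K})$, i.e. a $\mathbb{K}$-linear skew-symmetric map which satisfies the co-Jacobi identity and the 1-cocycle condition $\bar\delta([x,y])=x\cdot\bar\delta(y)-y\cdot\bar\delta(x)$. Let $D(\mathfrak{g}(\mathbb{K}),\bar\delta)$ be its classical double: the vector space $\mathfrak{g}(\mathbb{K})\oplus\mathfrak{g}(\mathbb{K})^{*}$ with the unique Lie bracket that extends the bracket of $\mathfrak{g}(\mathbb{K})$ and the bracket $[f,g]=(f\otimes g)\circ\bar\delta$ of $\mathfrak{g}(\mathbb{K})^{*}$ and for which the canonical symmetric bilinear form $\langle (x,f),(y,g)\rangle=f(y)+g(x)$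 is invariant. Then, as a Lie algebra over $\mathbb{K}$, $D(\mathfrak{g}(\mathbb{K}),\bar\delta)$ is isomorphic to $\mathfrak{g}(\mathbb{K})\otimes_{\mathbb{K}}A$, with bracket $[x\otimes a,y\otimes b]=[x,y]\otimes ab$, where $A$ is one of the following three commutative $\mathbb{K}$-algebras: $A=\mathbb{K}[\varepsilon]$ with $\varepsilon^{2}=0$; $A=\mathbb{K}\oplus\mathbb{K}$; or $A=\mathbb{K}[j]$ with $j^{2}=\hbar$. -/

import Mathlib

open scoped TensorProduct

/-- The Laurent series field `ℂ((ħ))` as an algebra over `ℂ` through constant series. Mathlib has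
this instance; it is repeated here so that it is preferred to the algebra structure that factors
through power series. -/
noncomputable instance laurentSeriesAlgebra : Algebra ℂ (LaurentSeries ℂ) :=
  HahnSeries.instAlgebra

instance laurentSeriesCharZero : CharZero (LaurentSeries ℂ) :=
  charZero_of_injective_algebraMap (algebraMap ℂ (LaurentSeries ℂ)).injective

/-- The Lie algebra `L ⊗ A` over `K`, for a Lie algebra `L` over `K` and a commutative `K`-algebra
`A`, with the bracket `[a ⊗ x, b ⊗ y] = ab ⊗ [x, y]` (the factor `A` is written on the left). -/
abbrev LieExtend (K A L : Type*) [Field K] [CommRing A] [Algebra K A] [LieRing L]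
    [LieAlgebra K L] : Type _ :=
  A ⊗[K] L

/-- The cyclic permutation `(a ⊗ b) ⊗ c ↦ (b ⊗ c) ⊗ a` of the third tensor power. -/
noncomputable def tensorCyc (K L : Type*) [CommRing K] [AddCommGroup L] [Module K L] :
    (L ⊗[K] L) ⊗[K] L ≃ₗ[K] (L ⊗[K] L) ⊗[K] L :=
  (TensorProduct.assoc K L L L).trans (TensorProduct.comm K L (L ⊗[K] L))

/-- A Lie bialgebra structure on the Lie algebra `L`: a linear map `δ : L → L ⊗ L` that is
skew-symmetric, satisfies the co-Jacobi identity, and is a 1-cocycle for the action of `L` on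
`L ⊗ L` by `x · (a ⊗ b) = [x, a] ⊗ b + a ⊗ [x, b]`. -/
structure LieBialgebraStructure (K L : Type*) [Field K] [LieRing L] [LieAlgebra K L] where
  /-- the cobracket -/
  cobracket : L →ₗ[K] L ⊗[K] L
  skew : ∀ x, TensorProduct.comm K L L (cobracket x) = -cobracket x
  coJacobi : ∀ x,
    cobracket.rTensor L (cobracket x)
      + tensorCyc K L (cobracket.rTensor L (cobracket x))
      + tensorCyc K L (tensorCyc K L (cobracket.rTensor L (cobracket x))) = 0
  cocycle : ∀ x y, cobracket ⁅x, y⁆ = ⁅x, cobracket y⁆ - ⁅y, cobracket x⁆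

/-- The contraction `f ⊗ id : L ⊗ L → L`, `a ⊗ b ↦ f a • b`. -/
noncomputable def contractFst {K L : Type*} [Field K] [AddCommGroup L] [Module K L]
    (f : Module.Dual K L) : L ⊗[K] L →ₗ[K] L :=
  (TensorProduct.lid K L).toLinearMap ∘ₗ f.rTensor L

section contract

variable {K L : Type*} [Field K] [LieRing L] [LieAlgebra K L]

@[simp]
theorem contractFst_tmul (f : Module.Dual K L) (a b : L) :
    contractFst f (a ⊗ₜ[K] b) = f a • b := by
  simp [contractFst]

theorem contractFst_add (f g : Module.Dual K L) (t : L ⊗[K] L) :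
    contractFst (f + g) t = contractFst f t + contractFst g t := by
  simp [contractFst, LinearMap.rTensor_add]

theorem contractFst_sub (f g : Module.Dual K L) (t : L ⊗[K] L) :
    contractFst (f - g) t = contractFst f t - contractFst g t := by
  simp [contractFst, LinearMap.rTensor_sub]

theorem contractFst_neg (f : Module.Dual K L) (t : L ⊗[K] L) :
    contractFst (-f) t = -contractFst f t := by
  simp [contractFst, LinearMap.rTensor_neg]

theorem contractFst_smul (c : K) (f : Module.Dual K L) (t : L ⊗[K] L) :
    contractFst (c • f) t = c • contractFst f t := by
  simp [contractFst, LinearMap.rTensor_smul]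

theorem apply_contractFst_comm (f g : Module.Dual K L) (t : L ⊗[K] L) :
    f (contractFst g t) = g (contractFst f (TensorProduct.comm K L L t)) := by
  induction t with
  | zero => simp
  | tmul a b => simp [mul_comm]
  | add s t hs ht => simp only [map_add, hs, ht]

theorem contractFst_lie (f : Module.Dual K L) (x : L) (t : L ⊗[K] L) :
    contractFst f ⁅x, t⁆ =
      contractFst (f ∘ₗ (LieAlgebra.ad K L x : L →ₗ[K] L)) t + ⁅x, contractFst f t⁆ := by
  induction t with
  | zero => simp
  | tmul a b => simp [TensorProduct.LieModule.lie_tmul_right]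
  | add s t hs ht => simp only [map_add, lie_add, hs, ht]; abel

end contract

namespace LieBialgebraStructure

variable {K L : Type*} [Field K] [LieRing L] [LieAlgebra K L]

/-- The underlying vector space `L ⊕ L*` of the classical double `D(L, δ)`. -/
@[ext]
structure Double (_δ : LieBialgebraStructure K L) where
  /-- the component in `L` -/
  fst : L
  /-- the component in `L*` -/
  snd : Module.Dual K L

variable (δ : LieBialgebraStructure K L)

/-- The identification of the double with `L × L*`, which transports the vector space structure. -/
def Double.equivProd : δ.Double ≃ L × Module.Dual K L where
  toFun u := (u.fst, u.snd)
  invFun p := ⟨p.1, p.2⟩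

noncomputable instance : AddCommGroup δ.Double := (Double.equivProd δ).addCommGroup

noncomputable instance : Module K δ.Double := (Double.equivProd δ).module K

/-- The map `(f ⊗ id) ∘ δ : L → L`. -/
noncomputable def contr (f : Module.Dual K L) : L →ₗ[K] L := contractFst f ∘ₗ δ.cobracket

/-- The bracket of `L*` dual to the cobracket, `[f, g] = (f ⊗ g) ∘ δ`. -/
noncomputable def dualBracket (f g : Module.Dual K L) : Module.Dual K L :=
  (TensorProduct.lid K K).toLinearMap ∘ₗ TensorProduct.map f g ∘ₗ δ.cobracket

/-- The coadjoint action of `L` on `L*`, `(ad*_x f) z = -f [x, z]`. -/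
def coad (x : L) (f : Module.Dual K L) : Module.Dual K L :=
  -(f ∘ₗ (LieAlgebra.ad K L x : L →ₗ[K] L))

/-- The bracket of the classical double. It extends the brackets of `L` and of `L*`, and
for `x` in `L` and `g` in `L*` it is given by `[x, g] = ad*_x g + (g ⊗ id)(δ x)`, which is the
only choice for which the canonical form `⟨(x, f), (y, g)⟩ = f y + g x` is invariant. -/
noncomputable instance : Bracket δ.Double δ.Double where
  bracket u v :=
    ⟨⁅u.fst, v.fst⁆ + δ.contr v.snd u.fst - δ.contr u.snd v.fst,
      δ.dualBracket u.snd v.snd + coad u.fst v.snd - coad v.fst u.snd⟩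

theorem contr_apply (f : Module.Dual K L) (x : L) :
    δ.contr f x = contractFst f (δ.cobracket x) := rfl

theorem dualBracket_apply (f g : Module.Dual K L) (x : L) :
    δ.dualBracket f g x = g (δ.contr f x) := by
  simp only [dualBracket, contr_apply, LinearMap.comp_apply, LinearEquiv.coe_coe]
  generalize δ.cobracket x = t
  induction t with
  | zero => simp
  | tmul a b => simp
  | add s t hs ht => simp only [map_add, hs, ht]

theorem coad_apply (x z : L) (f : Module.Dual K L) : coad x f z = -f ⁅x, z⁆ := by
  simp [coad]

theorem contr_add (f g : Module.Dual K L) (x : L) :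
    δ.contr (f + g) x = δ.contr f x + δ.contr g x := contractFst_add ..

theorem contr_sub (f g : Module.Dual K L) (x : L) :
    δ.contr (f - g) x = δ.contr f x - δ.contr g x := contractFst_sub ..

theorem contr_smul (c : K) (f : Module.Dual K L) (x : L) :
    δ.contr (c • f) x = c • δ.contr f x := contractFst_smul ..

theorem apply_contr (f g : Module.Dual K L) (x : L) :
    f (δ.contr g x) = -g (δ.contr f x) := by
  rw [contr_apply, apply_contractFst_comm, δ.skew, map_neg, map_neg, contr_apply]

theorem contr_lie (f : Module.Dual K L) (x y : L) :
    δ.contr f ⁅x, y⁆ =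
      -δ.contr (coad x f) y + ⁅x, δ.contr f y⁆ + δ.contr (coad y f) x - ⁅y, δ.contr f x⁆ := by
  simp only [contr_apply, δ.cocycle, map_sub, contractFst_lie, coad, contractFst_neg]
  abel

theorem contr_dualBracket (f g : Module.Dual K L) (x : L) :
    δ.contr (δ.dualBracket f g) x = δ.contr g (δ.contr f x) - δ.contr f (δ.contr g x) := by
  -- the three contractions `f ⊗ g ⊗ id` of the three terms of the co-Jacobi identity
  have h1 : ∀ t : L ⊗[K] L,
      contractFst g ((contractFst f).rTensor L (δ.cobracket.rTensor L t)) =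
        contractFst (δ.dualBracket f g) t := by
    intro t
    induction t with
    | zero => simp
    | tmul a b => simp [dualBracket_apply, contr_apply]
    | add s t hs ht => simp only [map_add, hs, ht]
  have c2 : ∀ (s : L ⊗[K] L) (b : L),
      contractFst g ((contractFst f).rTensor L (tensorCyc K L (s ⊗ₜ b))) =
        g b • contractFst f (TensorProduct.comm K L L s) := by
    intro s b
    induction s with
    | zero => simp
    | tmul a c => simp [tensorCyc, smul_smul, mul_comm]
    | add s t hs ht => simp only [map_add, TensorProduct.add_tmul, hs, ht, smul_add]
  have h2 : ∀ t : L ⊗[K] L,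
      contractFst g ((contractFst f).rTensor L (tensorCyc K L (δ.cobracket.rTensor L t))) =
        -δ.contr f (contractFst g (TensorProduct.comm K L L t)) := by
    intro t
    induction t with
    | zero => simp
    | tmul a b =>
      rw [LinearMap.rTensor_tmul, c2, δ.skew]
      simp [contr_apply]
    | add s t hs ht => simp only [map_add, hs, ht, neg_add]
  have c3 : ∀ (s : L ⊗[K] L) (b : L),
      contractFst g ((contractFst f).rTensor L (tensorCyc K L (tensorCyc K L (s ⊗ₜ b)))) =
        f b • contractFst g s := by
    intro s b
    induction s with
    | zero => simp
    | tmul a c => simp [tensorCyc, smul_smul]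
    | add s t hs ht => simp only [map_add, TensorProduct.add_tmul, hs, ht, smul_add]
  have h3 : ∀ t : L ⊗[K] L,
      contractFst g ((contractFst f).rTensor L
        (tensorCyc K L (tensorCyc K L (δ.cobracket.rTensor L t)))) =
        δ.contr g (contractFst f (TensorProduct.comm K L L t)) := by
    intro t
    induction t with
    | zero => simp
    | tmul a b =>
      rw [LinearMap.rTensor_tmul, c3]
      simp [contr_apply]
    | add s t hs ht => simp only [map_add, hs, ht]
  have h := congrArg (fun t => contractFst g ((contractFst f).rTensor L t)) (δ.coJacobi x)
  simp only [map_add, map_zero, h1, h2, h3, δ.skew, map_neg, neg_neg] at h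
  rw [contr_apply]
  simp only [← contr_apply] at h ⊢
  rw [← sub_eq_zero, ← h]
  abel

@[simp] theorem Double.add_fst (u v : δ.Double) : (u + v).fst = u.fst + v.fst := rfl
@[simp] theorem Double.add_snd (u v : δ.Double) : (u + v).snd = u.snd + v.snd := rfl
@[simp] theorem Double.zero_fst : (0 : δ.Double).fst = 0 := rfl
@[simp] theorem Double.zero_snd : (0 : δ.Double).snd = 0 := rfl
@[simp] theorem Double.smul_fst (c : K) (u : δ.Double) : (c • u).fst = c • u.fst := rfl
@[simp] theorem Double.smul_snd (c : K) (u : δ.Double) : (c • u).snd = c • u.snd := rfl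
theorem Double.lie_fst (u v : δ.Double) :
    ⁅u, v⁆.fst = ⁅u.fst, v.fst⁆ + δ.contr v.snd u.fst - δ.contr u.snd v.fst := rfl
theorem Double.lie_snd (u v : δ.Double) :
    ⁅u, v⁆.snd = δ.dualBracket u.snd v.snd + coad u.fst v.snd - coad v.fst u.snd := rfl

theorem Double.lie_snd_apply (u v : δ.Double) (z : L) :
    ⁅u, v⁆.snd z = v.snd (δ.contr u.snd z) - v.snd ⁅u.fst, z⁆ + u.snd ⁅v.fst, z⁆ := by
  rw [Double.lie_snd]
  simp only [LinearMap.sub_apply, LinearMap.add_apply, dualBracket_apply, coad_apply]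
  ring

noncomputable instance [CharZero K] : LieRing δ.Double where
  add_lie u v w := by
    refine Double.ext ?_ (LinearMap.ext fun z => ?_)
    · simp only [Double.lie_fst, Double.add_fst, Double.add_snd, contr_add, add_lie, map_add]
      abel
    · simp only [Double.lie_snd_apply, Double.add_fst, Double.add_snd, contr_add, add_lie,
        map_add, LinearMap.add_apply]
      ring
  lie_add u v w := by
    refine Double.ext ?_ (LinearMap.ext fun z => ?_)
    · simp only [Double.lie_fst, Double.add_fst, Double.add_snd, contr_add, lie_add, map_add]
      abel
    · simp only [Double.lie_snd_apply, Double.add_fst, Double.add_snd, add_lie,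
        map_add, LinearMap.add_apply]
      ring
  lie_self u := by
    refine Double.ext ?_ (LinearMap.ext fun z => ?_)
    · simp [Double.lie_fst]
    · have h := δ.apply_contr u.snd u.snd z
      rw [eq_neg_iff_add_eq_zero, ← two_mul] at h
      have h' : u.snd (δ.contr u.snd z) = 0 := by simpa using h
      simp [Double.lie_snd_apply, h']
  leibniz_lie := by
    rintro ⟨x, f⟩ ⟨y, g⟩ ⟨w, h⟩
    refine Double.ext ?_ (LinearMap.ext fun z => ?_)
    · simp only [Double.lie_fst, Double.lie_snd, Double.add_fst, contr_add, contr_sub,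
        contr_dualBracket, contr_lie, map_add, map_sub, lie_add, lie_sub, add_lie, sub_lie,
        leibniz_lie x y w]
      rw [← lie_skew w (δ.contr f y), ← lie_skew w (δ.contr g x)]
      abel
    · -- the cocycle identity, contracted with two functionals
      have hC : ∀ (p q : Module.Dual K L) (a b : L), p (δ.contr q ⁅a, b⁆) =
          -q ⁅a, δ.contr p b⁆ + p ⁅a, δ.contr q b⁆ + q ⁅b, δ.contr p a⁆
            - p ⁅b, δ.contr q a⁆ := by
        intro p q a b
        rw [contr_lie]
        simp only [map_add, map_sub, map_neg, δ.apply_contr p (coad _ _), coad_apply]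
        ring
      -- moving the functional through the bracket
      have hN : ∀ (p : Module.Dual K L) (a b : L), p ⁅a, b⁆ = -p ⁅b, a⁆ := by
        intro p a b
        rw [← lie_skew, map_neg]
      have j1 := congrArg f (lie_lie y w z)
      have j2 := congrArg g (lie_lie x w z)
      have j3 := congrArg h (lie_lie x y z)
      simp only [map_sub] at j1 j2 j3
      simp only [Double.lie_fst, Double.lie_snd, Double.add_snd,
        LinearMap.add_apply, LinearMap.sub_apply, dualBracket_apply, coad_apply,
        contr_add, contr_sub, contr_dualBracket, δ.apply_contr _ (coad _ _),
        map_add, map_sub, add_lie, sub_lie]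
      rw [hN h (δ.contr g x) z, hN h (δ.contr f y) z, hN f (δ.contr h y) z,
        hN f (δ.contr g w) z, hN g (δ.contr h x) z, hN g (δ.contr f w) z]
      linear_combination -hC h g x z + hC h f y z - hC g f w z + j1 - j2 + j3

noncomputable instance [CharZero K] : LieAlgebra K δ.Double where
  lie_smul c u v := by
    refine Double.ext ?_ (LinearMap.ext fun z => ?_)
    · simp only [Double.lie_fst, Double.smul_fst, Double.smul_snd, contr_smul, map_smul, lie_smul,
        smul_add, smul_sub]
    · simp only [Double.lie_snd_apply, Double.smul_fst, Double.smul_snd, map_smul, smul_lie,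
        LinearMap.smul_apply, smul_eq_mul]
      ring

end LieBialgebraStructure

/-! Write L for g(K) and D for its double. D carries two invariant symmetric forms: the canonical
one, nondegenerate with L isotropic, and the Killing form, which restricts to twice the Killing form
of L. The operator T expressing the second through the first (`Double.killingEnd`) commutes with the
adjoint action. As L is isotropic and has nondegenerate Killing form, TL meets L in 0, so D = L ⊕ TL
by dimension (`Double.prod_bijective`).

In this decomposition T² on L has two components, both commuting with ad L. The centroid of L is K
(`LieAlgebra.IsSimple.exists_eq_smul_baseChange`), so T² = b + aT with scalars a, b. Completing the
square gives T² = d, hence D ≅ L ⊗ K[u]/(u² - d). Only the class of d modulo nonzero squares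
matters, and in ℂ((ħ)) the classes are 0, 1 and ħ (`LaurentSeries.exists_eq_mul_self_or`), which
yield the three algebras. -/

namespace LieBialgebraStructure

/-! ### The canonical form of the double. -/

variable {K L : Type*} [Field K] [LieRing L] [LieAlgebra K L] (δ : LieBialgebraStructure K L)

/-- The linear equivalence between the double and `L × L*`. -/
noncomputable def Double.linearEquivProd : δ.Double ≃ₗ[K] L × Module.Dual K L where
  __ := Double.equivProd δ
  map_add' _ _ := rfl
  map_smul' _ _ := rfl

instance [Module.Finite K L] : Module.Finite K δ.Double :=
  Module.Finite.equiv (Double.linearEquivProd δ).symm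

theorem Double.finrank_eq [Module.Finite K L] :
    Module.finrank K δ.Double = Module.finrank K (L × L) := by
  rw [(Double.linearEquivProd δ).finrank_eq, Module.finrank_prod, Module.finrank_prod,
    Subspace.dual_finrank_eq]

/-- The inclusion of `L` into the double. -/
noncomputable def Double.inl : L →ₗ[K] δ.Double :=
  (Double.linearEquivProd δ).symm.toLinearMap ∘ₗ LinearMap.inl K L (Module.Dual K L)

@[simp] theorem Double.inl_fst (x : L) : (Double.inl δ x).fst = x := rfl
@[simp] theorem Double.inl_snd (x : L) : (Double.inl δ x).snd = 0 := rfl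

/-- The canonical symmetric bilinear form `⟨(x, f), (y, g)⟩ = f y + g x` of the double. -/
noncomputable def Double.form : LinearMap.BilinForm K δ.Double :=
  LinearMap.mk₂ K (fun u v => u.snd v.fst + v.snd u.fst)
    (fun u v w => by simp only [Double.add_fst, Double.add_snd, LinearMap.add_apply, map_add]; ring)
    (fun c u v => by
      simp only [Double.smul_fst, Double.smul_snd, LinearMap.smul_apply, map_smul, smul_eq_mul]
      ring)
    (fun u v w => by simp only [Double.add_fst, Double.add_snd, LinearMap.add_apply, map_add]; ring)
    (fun c u v => by
      simp only [Double.smul_fst, Double.smul_snd, LinearMap.smul_apply, map_smul, smul_eq_mul]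
      ring)

theorem Double.form_apply (u v : δ.Double) :
    Double.form δ u v = u.snd v.fst + v.snd u.fst := rfl

theorem Double.form_nondegenerate : (Double.form δ).Nondegenerate := by
  have hsymm : (Double.form δ).IsSymm := ⟨fun u v => by
    simp [Double.form_apply, add_comm]⟩
  refine hsymm.isRefl.nondegenerate_iff_separatingLeft.mpr fun u hu => ?_
  refine Double.ext ?_ (LinearMap.ext fun z => ?_)
  · refine (Module.forall_dual_apply_eq_zero_iff K u.fst).mp fun g => ?_
    simpa [Double.form_apply] using hu ⟨0, g⟩
  · simpa [Double.form_apply] using hu (Double.inl δ z)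

theorem contr_zero (x : L) : δ.contr 0 x = 0 := by simp [contr_apply, contractFst]

theorem Double.lie_inl_inl (x y : L) : ⁅Double.inl δ x, Double.inl δ y⁆ = Double.inl δ ⁅x, y⁆ := by
  refine Double.ext ?_ (LinearMap.ext fun z => ?_)
  · simp [Double.lie_fst, contr_zero]
  · simp [Double.lie_snd_apply]

/-- Cyclicity of the trace turns the two blocks into φ composed with complementary projections,
which sum to the identity. -/
theorem _root_.LinearMap.trace_prod_eq {M N : Type*} [AddCommGroup M] [Module K M] [Module.Finite K M]
    [AddCommGroup N] [Module K N] [Module.Finite K N] (φ : M × N →ₗ[K] M × N) :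
    LinearMap.trace K (M × N) φ =
      LinearMap.trace K M (LinearMap.fst K M N ∘ₗ φ ∘ₗ LinearMap.inl K M N) +
      LinearMap.trace K N (LinearMap.snd K M N ∘ₗ φ ∘ₗ LinearMap.inr K M N) := by
  rw [LinearMap.trace_comp_comm' (φ ∘ₗ LinearMap.inl K M N),
    LinearMap.trace_comp_comm' (φ ∘ₗ LinearMap.inr K M N), ← map_add]
  congr 1
  ext x <;> simp [Prod.mk_zero_zero]

theorem Double.form_lie (u v w : δ.Double) :
    Double.form δ ⁅u, v⁆ w = Double.form δ u ⁅v, w⁆ := by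
  simp only [Double.form_apply, Double.lie_fst, Double.lie_snd_apply, map_add, map_sub]
  rw [δ.apply_contr w.snd u.snd, δ.apply_contr w.snd v.snd, δ.apply_contr v.snd u.snd,
    ← lie_skew u.fst w.fst,
    ← lie_skew u.fst v.fst]
  simp only [map_neg]
  ring

/-! ### The Killing form of the double and the splitting it induces. -/

variable [CharZero K]

/-- L is a subalgebra, so its action on D is block triangular: adjoint on L, coadjoint on D/L ≅ L*.
Each block contributes one copy of the Killing form of L. -/
theorem Double.killingForm_inl_inl [Module.Finite K L] (x y : L) :
    killingForm K δ.Double (Double.inl δ x) (Double.inl δ y) = 2 * killingForm K L x y := by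
  rw [killingForm_apply_apply, ← LinearMap.trace_conj' _ (Double.linearEquivProd δ),
    LinearMap.trace_prod_eq, two_mul]
  congr 1
  · rw [killingForm_apply_apply]
    congr 1
    ext z
    change ⁅Double.inl δ x, ⁅Double.inl δ y, Double.inl δ z⁆⁆.fst = _
    simp [Double.lie_inl_inl]
  -- Transposition reverses composition, hence the swap of x and y; the two signs of the coadjoint
  -- action cancel.
  · rw [LieModule.traceForm_comm, killingForm_apply_apply,
      ← LinearMap.trace_transpose' (LieAlgebra.ad K L y ∘ₗ LieAlgebra.ad K L x)]
    congr 1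
    refine LinearMap.ext fun f => LinearMap.ext fun z => ?_
    change ⁅Double.inl δ x, ⁅Double.inl δ y, (⟨0, f⟩ : δ.Double)⁆⁆.snd z = _
    simp [Double.lie_snd_apply, contr_zero, Module.Dual.transpose_apply]

/-- The endomorphism of the double that turns the canonical form into the Killing form. -/
noncomputable def Double.killingEnd [Module.Finite K L] : Module.End K δ.Double :=
  (killingForm K δ.Double).symmCompOfNondegenerate _ (Double.form_nondegenerate δ)

theorem Double.form_killingEnd [Module.Finite K L] (u v : δ.Double) :
    Double.form δ (Double.killingEnd δ u) v = killingForm K δ.Double u v :=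
  LinearMap.BilinForm.symmCompOfNondegenerate_left_apply _ _ _ _

/-- Both forms are invariant, and the canonical one is nondegenerate. -/
theorem Double.killingEnd_lie [Module.Finite K L] (u v : δ.Double) :
    Double.killingEnd δ ⁅u, v⁆ = ⁅Double.killingEnd δ u, v⁆ := by
  rw [← sub_eq_zero]
  refine (Double.form_nondegenerate δ).1 _ fun w => ?_
  rw [map_sub, LinearMap.sub_apply, Double.form_lie, Double.form_killingEnd,
    Double.form_killingEnd, LieModule.traceForm_apply_lie_apply, sub_self]

/-- Pairing a relation x + (T - a)y = 0 with L kills x and ay by isotropy and leaves twice the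
Killing form of L at y, so y = 0. The shift a is free, so T can later be replaced by its translate.
-/
theorem Double.prod_bijective [Module.Finite K L] [LieAlgebra.IsKilling K L] (a : K) :
    Function.Bijective ((Double.inl δ).coprod
      ((Double.killingEnd δ - a • (1 : Module.End K δ.Double)) ∘ₗ Double.inl δ)) := by
  have hinj : Function.Injective ((Double.inl δ).coprod
      ((Double.killingEnd δ - a • (1 : Module.End K δ.Double)) ∘ₗ Double.inl δ)) := by
    rw [injective_iff_map_eq_zero]
    rintro ⟨x, y⟩ h
    have hiso : ∀ x y, Double.form δ (Double.inl δ x) (Double.inl δ y) = 0 := fun x y => by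
      simp [Double.form_apply]
    have hy : y = 0 := by
      refine (LieAlgebra.IsKilling.killingForm_nondegenerate K L).1 _ fun z => ?_
      have h1 := congrArg (fun u => Double.form δ u (Double.inl δ z)) h
      simpa [hiso, Double.form_killingEnd, Double.killingForm_inl_inl] using h1
    have hx := congrArg Double.fst h
    simp only [hy, LinearMap.coprod_apply, map_zero, add_zero, Double.inl_fst,
      Double.zero_fst] at hx
    rw [hx, hy]
    rfl
  refine ⟨hinj, ?_⟩
  exact (LinearMap.injective_iff_surjective_of_finrank_eq_finrank
    (Double.finrank_eq δ).symm).mp hinj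

/-- The hypothesis `hL` says that the centroid of L is K; it forces a quadratic equation on T, whose
linear term is then removed. -/
theorem Double.exists_end [Module.Finite K L] [LieAlgebra.IsKilling K L]
    (hL : ∀ A : Module.End K L, (∀ x y : L, A ⁅x, y⁆ = ⁅x, A y⁆) → ∃ c : K, ∀ x, A x = c • x) :
    ∃ (d : K) (T : Module.End K δ.Double), (∀ u v, T ⁅u, v⁆ = ⁅T u, v⁆) ∧
      T * T = d • 1 ∧
      Function.Bijective ((Double.inl δ).coprod (T ∘ₗ Double.inl δ)) := by
  set T := Double.killingEnd δ with hT
  have hlie : ∀ u v, T ⁅u, v⁆ = ⁅u, T v⁆ := fun u v => by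
    rw [← lie_skew, map_neg, Double.killingEnd_lie, lie_skew]
  have hbij := Double.prod_bijective δ 0
  rw [zero_smul, sub_zero, ← hT] at hbij
  set S : (L × L) ≃ₗ[K] δ.Double := LinearEquiv.ofBijective _ hbij with hS
  have hSapp : ∀ p, S p = Double.inl δ p.1 + T (Double.inl δ p.2) := fun p => by
    simp [hS]
  -- The coordinates of T² on L in the splitting D = L ⊕ TL.
  set C : L →ₗ[K] L × L := S.symm.toLinearMap ∘ₗ T ∘ₗ T ∘ₗ Double.inl δ with hC
  have hCapp : ∀ x, T (T (Double.inl δ x)) =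
      Double.inl δ (C x).1 + T (Double.inl δ (C x).2) := fun x => by
    rw [← hSapp]; simp [hC]
  have hCeq : ∀ x y, C ⁅x, y⁆ = (⁅x, (C y).1⁆, ⁅x, (C y).2⁆) := fun x y => by
    apply S.injective
    rw [hSapp, ← hCapp, hSapp, ← Double.lie_inl_inl, hlie, hlie, hCapp, lie_add, ← hlie,
      Double.lie_inl_inl, Double.lie_inl_inl]
  obtain ⟨b, hb⟩ := hL (LinearMap.fst K L L ∘ₗ C) fun x y => by simp [hCeq]
  obtain ⟨a, ha⟩ := hL (LinearMap.snd K L L ∘ₗ C) fun x y => by simp [hCeq]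
  simp only [LinearMap.comp_apply, LinearMap.fst_apply, LinearMap.snd_apply] at ha hb
  have hTT : ∀ x, T (T (Double.inl δ x)) = b • Double.inl δ x + a • T (Double.inl δ x) :=
    fun x => by rw [hCapp, ha, hb, map_smul, map_smul, map_smul]
  have hTT' : ∀ u, T (T u) = b • u + a • T u := fun u => by
    obtain ⟨p, rfl⟩ := S.surjective u
    rw [hSapp]
    simp only [map_add, hTT, map_smul, smul_add]
    abel
  -- Completing the square in T² = b + aT.
  refine ⟨b + a ^ 2 / 4, T - (a / 2) • (1 : Module.End K δ.Double), fun u v => ?_, ?_,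
    Double.prod_bijective δ _⟩
  · simp [Double.killingEnd_lie, hT]
  · ext1 u
    simp only [Module.End.mul_apply, LinearMap.sub_apply, LinearMap.smul_apply,
      Module.End.one_apply, map_sub, map_smul, hTT']
    module

end LieBialgebraStructure

/-! ### Quadratic algebras up to isomorphism, and the double as L ⊗ A. -/

section quadratic

variable {K : Type*} [Field K]

/-- An algebra spanned freely by `1` and `u` with `u² = d` is the quadratic algebra. -/
theorem nonempty_quadraticAlgebra_algEquiv {A : Type*} [CommRing A] [Algebra K A] {d : K} (u : A)
    (hu : u * u = algebraMap K A d) (hli : ∀ r s : K, r • (1 : A) + s • u = 0 → r = 0 ∧ s = 0)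
    (hA : Module.finrank K A = 2) : Nonempty (QuadraticAlgebra K d 0 ≃ₐ[K] A) := by
  let φ : QuadraticAlgebra K d 0 →ₐ[K] A :=
    QuadraticAlgebra.lift ⟨u, by rw [hu, zero_smul, add_zero, Algebra.algebraMap_eq_smul_one]⟩
  have hinj : Function.Injective φ.toLinearMap := by
    rw [injective_iff_map_eq_zero]
    intro z hz
    obtain ⟨h1, h2⟩ := hli z.re z.im hz
    exact QuadraticAlgebra.ext h1 h2
  have : FiniteDimensional K A := Module.finite_of_finrank_eq_succ hA
  exact ⟨AlgEquiv.ofBijective φ ⟨hinj, (LinearMap.injective_iff_surjective_of_finrank_eq_finrank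
    (by rw [hA, QuadraticAlgebra.finrank_eq_two])).mp hinj⟩⟩

theorem nonempty_quadraticAlgebra_zero_algEquiv_dualNumber :
    Nonempty (QuadraticAlgebra K 0 0 ≃ₐ[K] DualNumber K) := by
  refine nonempty_quadraticAlgebra_algEquiv DualNumber.eps (by simp) (fun r s h => ?_) ?_
  · exact ⟨by simpa using congrArg TrivSqZeroExt.fst h, by simpa using congrArg TrivSqZeroExt.snd h⟩
  · change Module.finrank K (K × K) = 2
    simp

theorem nonempty_quadraticAlgebra_sq_algEquiv_prod [CharZero K] {s : K} (hs : s ≠ 0) :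
    Nonempty (QuadraticAlgebra K (s * s) 0 ≃ₐ[K] K × K) := by
  -- The two square roots of s² serve as the coordinates of u; they differ because 2s ≠ 0.
  refine nonempty_quadraticAlgebra_algEquiv (s, -s) (by ext <;> simp) (fun p q h => ?_) (by simp)
  have h1 : p + q * s = 0 := by simpa using congrArg Prod.fst h
  have h2 : p + -(q * s) = 0 := by simpa using congrArg Prod.snd h
  have hp : 2 * p = 0 := by linear_combination h1 + h2
  have hq : 2 * q * s = 0 := by linear_combination h1 - h2
  simp_all

/-- Rescaling the generator by s multiplies its square by s². -/
theorem nonempty_quadraticAlgebra_mul_sq_algEquiv {s : K} (hs : s ≠ 0) (d : K) :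
    Nonempty (QuadraticAlgebra K (s * s * d) 0 ≃ₐ[K] QuadraticAlgebra K d 0) := by
  refine nonempty_quadraticAlgebra_algEquiv ⟨0, s⟩ ?_ (fun p q h => ?_)
    (QuadraticAlgebra.finrank_eq_two _ _)
  · ext <;> simp [QuadraticAlgebra.algebraMap_eq, mul_comm, mul_left_comm]
  · have h1 := congrArg QuadraticAlgebra.re h
    have h2 := congrArg QuadraticAlgebra.im h
    simp only [QuadraticAlgebra.re_add, QuadraticAlgebra.re_smul, QuadraticAlgebra.re_one,
      QuadraticAlgebra.re_zero, QuadraticAlgebra.im_add, QuadraticAlgebra.im_smul,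
      QuadraticAlgebra.im_one, QuadraticAlgebra.im_zero, smul_eq_mul] at h1 h2
    simp_all

variable {L : Type*} [LieRing L] [LieAlgebra K L]

/-- An isomorphism of coefficient algebras extends to the Lie algebras `L ⊗ A`. -/
noncomputable def LieExtend.congr {A B : Type*} [CommRing A] [Algebra K A] [CommRing B]
    [Algebra K B] (e : A ≃ₐ[K] B) : LieExtend K A L ≃ₗ⁅K⁆ LieExtend K B L where
  __ := TensorProduct.congr e.toLinearEquiv (LinearEquiv.refl K L)
  map_lie' {u v} := by
    change TensorProduct.congr e.toLinearEquiv (LinearEquiv.refl K L) ⁅u, v⁆ =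
      ⁅TensorProduct.congr e.toLinearEquiv (LinearEquiv.refl K L) u,
        TensorProduct.congr e.toLinearEquiv (LinearEquiv.refl K L) v⁆
    induction u using TensorProduct.induction_on with
    | zero => simp
    | add u u' hu hu' => simp only [add_lie, map_add, hu, hu']
    | tmul a x =>
      induction v using TensorProduct.induction_on with
      | zero => simp
      | add v v' hv hv' => simp only [lie_add, map_add, hv, hv']
      | tmul b y => simp [LieAlgebra.ExtendScalars.bracket_tmul]

/-- If `A` acts on the double by endomorphisms that commute with the adjoint action and some `a` in
`A` gives the decomposition `L ⊕ a L` of the double, then the double is `L ⊗ A`. -/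
theorem LieBialgebraStructure.Double.nonempty_lieEquiv [CharZero K] [Module.Finite K L]
    (δ : LieBialgebraStructure K L) {A : Type*} [CommRing A] [Algebra K A]
    (hA : Module.finrank K A = 2) (ρ : A →ₐ[K] Module.End K δ.Double)
    (hρ : ∀ a u v, ρ a ⁅u, v⁆ = ⁅ρ a u, v⁆) (a : A)
    (ha : Function.Surjective ((inl δ).coprod (ρ a ∘ₗ inl δ))) :
    Nonempty (δ.Double ≃ₗ⁅K⁆ LieExtend K A L) := by
  have hρ' : ∀ a u v, ρ a ⁅u, v⁆ = ⁅u, ρ a v⁆ := fun a u v => by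
    rw [← lie_skew, map_neg, hρ, lie_skew]
  let Φ : A ⊗[K] L →ₗ[K] δ.Double :=
    TensorProduct.lift (LinearMap.lcomp K δ.Double (inl δ) ∘ₗ ρ.toLinearMap)
  have hΦ : ∀ b x, Φ (b ⊗ₜ x) = ρ b (inl δ x) := fun b x => by simp [Φ]
  have hsurj : Function.Surjective Φ := fun u => by
    obtain ⟨⟨x, y⟩, rfl⟩ := ha u
    exact ⟨1 ⊗ₜ x + a ⊗ₜ y, by simp [hΦ]⟩
  have hfin : Module.Finite K A := Module.finite_of_finrank_eq_succ hA
  have hinj : Function.Injective Φ :=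
    -- Both sides have dimension 2 dim L.
    (LinearMap.injective_iff_surjective_of_finrank_eq_finrank (by
      rw [finrank_eq, Module.finrank_tensorProduct, hA, Module.finrank_prod, two_mul])).mpr hsurj
  have hmul : ∀ u v, Φ ⁅u, v⁆ = ⁅Φ u, Φ v⁆ := fun u v => by
    induction u using TensorProduct.induction_on with
    | zero => simp
    | add u u' hu hu' => simp only [add_lie, map_add, hu, hu']
    | tmul b x =>
      induction v using TensorProduct.induction_on with
      | zero => simp
      | add v v' hv hv' => simp only [lie_add, map_add, hv, hv']
      | tmul c y =>
        -- (bc)[x, y] = b[x, cy] = [bx, cy], as the action passes through either slot of the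
        -- bracket.
        rw [LieAlgebra.ExtendScalars.bracket_tmul, hΦ, hΦ, hΦ, ← lie_inl_inl, map_mul,
          Module.End.mul_apply, hρ', hρ]
  let e : LieExtend K A L ≃ₗ⁅K⁆ δ.Double :=
    { LinearEquiv.ofBijective Φ ⟨hinj, hsurj⟩ with map_lie' := hmul _ _ }
  exact ⟨e.symm⟩

theorem LieBialgebraStructure.Double.exists_lieEquiv_quadraticAlgebra [CharZero K]
    [Module.Finite K L] [LieAlgebra.IsKilling K L]
    (hL : ∀ A : Module.End K L, (∀ x y : L, A ⁅x, y⁆ = ⁅x, A y⁆) → ∃ c : K, ∀ x, A x = c • x)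
    (δ : LieBialgebraStructure K L) :
    ∃ d : K, Nonempty (δ.Double ≃ₗ⁅K⁆ LieExtend K (QuadraticAlgebra K d 0) L) := by
  obtain ⟨d, T, hlie, hTT, hbij⟩ := exists_end δ hL
  let ρ : QuadraticAlgebra K d 0 →ₐ[K] Module.End K δ.Double :=
    QuadraticAlgebra.lift ⟨T, by rw [hTT, zero_smul, add_zero]⟩
  have hρ : ∀ z u, ρ z u = z.re • u + z.im • T u := fun z u => by
    simp [ρ, QuadraticAlgebra.lift]
  have hω : ρ ⟨0, 1⟩ = T := LinearMap.ext fun u => by simp [hρ]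
  exact ⟨d, nonempty_lieEquiv δ (QuadraticAlgebra.finrank_eq_two _ _) ρ
    (fun z u v => by simp only [hρ, hlie, add_lie, smul_lie]) ⟨0, 1⟩ (by rw [hω]; exact hbij.2)⟩

end quadratic

/-! ### Square classes of Laurent series. -/

theorem PowerSeries.exists_mul_self_eq {k : Type*} [Field k] [CharZero k] [IsAlgClosed k]
    (f : PowerSeries k) (hf : PowerSeries.constantCoeff f ≠ 0) : ∃ g, g * g = f := by
  obtain ⟨c, hc⟩ := IsAlgClosed.exists_pow_nat_eq (PowerSeries.constantCoeff f) two_pos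
  have hc0 : c ≠ 0 := fun h => hf (by simp [← hc, h])
  -- Normalizing the constant term to 1 allows u - 1 to be substituted into the binomial series (1 +
  -- X)^(1/2).
  set u : PowerSeries k := PowerSeries.C (c ^ 2)⁻¹ * f with hu
  have hs : PowerSeries.HasSubst (u - 1) :=
    PowerSeries.HasSubst.of_constantCoeff_zero' (by simp [hu, hc, hf])
  set b : PowerSeries k := PowerSeries.binomialSeries k (1 / 2 : ℚ) with hb
  have hbb : b * b = 1 + PowerSeries.X := by
    rw [hb, ← PowerSeries.binomialSeries_add, show (1 / 2 + 1 / 2 : ℚ) = ((1 : ℕ) : ℚ) by norm_num,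
      PowerSeries.binomialSeries_nat, pow_one]
  have h := congrArg (PowerSeries.substAlgHom (R := k) hs) hbb
  rw [map_mul, map_add, map_one, PowerSeries.substAlgHom_X, add_sub_cancel] at h
  refine ⟨PowerSeries.C c * PowerSeries.substAlgHom hs b, ?_⟩
  rw [mul_mul_mul_comm, h, hu, ← mul_assoc, ← map_mul, ← map_mul, ← pow_two,
    mul_inv_cancel₀ (pow_ne_zero 2 hc0), map_one, one_mul]

/-- The unit part of d is a square, so the class of d depends only on the parity of its order. -/
theorem LaurentSeries.exists_eq_mul_self_or {k : Type*} [Field k] [CharZero k] [IsAlgClosed k]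
    (d : LaurentSeries k) (hd : d ≠ 0) :
    ∃ s : LaurentSeries k, s ≠ 0 ∧ (d = s * s ∨ d = s * s * HahnSeries.single (1 : ℤ) (1 : k)) := by
  obtain ⟨g, hg⟩ := PowerSeries.exists_mul_self_eq d.powerSeriesPart (by
    rw [← PowerSeries.coeff_zero_eq_constantCoeff_apply, LaurentSeries.powerSeriesPart_coeff]
    simpa using hd)
  have hdec := d.single_order_mul_powerSeriesPart
  rw [← hg, map_mul] at hdec
  have hsq : ∀ m : ℤ, (HahnSeries.single m (1 : k) * HahnSeries.ofPowerSeries ℤ k g) *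
      (HahnSeries.single m (1 : k) * HahnSeries.ofPowerSeries ℤ k g) =
      HahnSeries.single (m + m) (1 : k) *
        (HahnSeries.ofPowerSeries ℤ k g * HahnSeries.ofPowerSeries ℤ k g) := fun m => by
    rw [mul_mul_mul_comm, HahnSeries.single_mul_single, mul_one]
  have hex : ∃ s : LaurentSeries k, d = s * s ∨ d = s * s * HahnSeries.single (1 : ℤ) (1 : k) := by
    obtain ⟨m, hm | hm⟩ := d.order.even_or_odd'
    · refine ⟨HahnSeries.single m 1 * HahnSeries.ofPowerSeries ℤ k g, Or.inl ?_⟩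
      rw [hsq, ← two_mul, ← hm, hdec]
    · refine ⟨HahnSeries.single m 1 * HahnSeries.ofPowerSeries ℤ k g, Or.inr ?_⟩
      rw [hsq, mul_right_comm, HahnSeries.single_mul_single, mul_one, ← two_mul, ← hm, hdec]
  obtain ⟨s, hs⟩ := hex
  refine ⟨s, ?_, hs⟩
  rintro rfl
  simp_all

/-! ### Killing form and centroid under extension of scalars. -/

theorem LieAlgebra.isKilling_baseChange {k K g : Type*} [Field k] [Field K] [Algebra k K]
    [LieRing g] [LieAlgebra k g] [Module.Finite k g] [LieAlgebra.IsKilling k g] :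
    LieAlgebra.IsKilling K (K ⊗[k] g) where
  killingCompl_top_eq_bot := by
    rw [eq_bot_iff]
    intro z hz
    rw [LieIdeal.mem_killingCompl] at hz
    have hnd := LieAlgebra.IsKilling.killingForm_nondegenerate k g
    let b := Module.finBasis k g
    let b' := (killingForm k g).dualBasis hnd b
    -- The Killing form commutes with base change, so pairing z with a dual basis of g reads off its
    -- coordinates.
    have hz' : ∀ i, (Algebra.TensorProduct.basis K b).repr z i = 0 := fun i => by
      have h := hz (1 ⊗ₜ b' i) trivial
      rw [← (Algebra.TensorProduct.basis K b).sum_repr z] at h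
      simpa [LieModule.traceForm_baseChange, b', LinearMap.BilinForm.apply_dualBasis_left,
        LinearMap.BilinForm.baseChange_tmul, Algebra.TensorProduct.basis_apply] using h
    have : z = 0 := (Algebra.TensorProduct.basis K b).ext_elem fun i => by simpa using hz' i
    simp [this]

/-- Schur's lemma: an eigenspace of A is a nonzero ideal. -/
theorem LieAlgebra.IsSimple.exists_eq_smul {k g : Type*} [Field k] [IsAlgClosed k] [LieRing g]
    [LieAlgebra k g] [Module.Finite k g] [LieAlgebra.IsSimple k g] (A : Module.End k g)
    (hA : ∀ x y : g, A ⁅x, y⁆ = ⁅x, A y⁆) : ∃ c : k, ∀ x, A x = c • x := by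
  have : Nontrivial g := by
    by_contra h
    rw [not_nontrivial_iff_subsingleton] at h
    exact LieAlgebra.IsSimple.non_abelian (R := k) (L := g) ⟨fun x y => Subsingleton.elim _ _⟩
  obtain ⟨c, hc⟩ := Module.End.exists_eigenvalue A
  let I : LieIdeal k g :=
    { Module.End.eigenspace A c with
      lie_mem := fun {x y} hy => by
        change ⁅x, y⁆ ∈ Module.End.eigenspace A c
        have hy' : A y = c • y := Module.End.mem_eigenspace_iff.mp hy
        rw [Module.End.mem_eigenspace_iff, hA, hy', lie_smul] }
  refine ⟨c, fun x => ?_⟩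
  rcases LieAlgebra.IsSimple.eq_bot_or_eq_top (R := k) I with h | h
  · exact absurd (congrArg LieSubmodule.toSubmodule h) hc
  · have hx : x ∈ I := h ▸ LieSubmodule.mem_top x
    exact Module.End.mem_eigenspace_iff.mp hx

/-- K need not be algebraically closed, so A may have no evident eigenvalue. Instead each k-linear
functional on K turns A into an endomorphism of g to which Schur's lemma applies. Since functionals
separate the points of K, the matrix of A is scalar. -/
theorem LieAlgebra.IsSimple.exists_eq_smul_baseChange {k K g : Type*} [Field k] [IsAlgClosed k]
    [Field K] [Algebra k K] [LieRing g] [LieAlgebra k g] [Module.Finite k g]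
    [LieAlgebra.IsSimple k g] (A : Module.End K (K ⊗[k] g))
    (hA : ∀ x y : K ⊗[k] g, A ⁅x, y⁆ = ⁅x, A y⁆) : ∃ c : K, ∀ x, A x = c • x := by
  let b := Module.finBasis k g
  let B := Algebra.TensorProduct.basis K b
  -- the coefficient of `A` along a functional on `K` is a scalar
  have hφ : ∀ φ : Module.Dual k K, ∃ c : k, ∀ x : g,
      TensorProduct.lid k g (φ.rTensor g (A (1 ⊗ₜ x))) = c • x := fun φ => by
    let Aφ : Module.End k g := (TensorProduct.lid k g).toLinearMap ∘ₗ φ.rTensor g ∘ₗ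
      A.restrictScalars k ∘ₗ TensorProduct.mk k K g 1
    have hlie : ∀ (x : g) (t : K ⊗[k] g), TensorProduct.lid k g (φ.rTensor g ⁅(1 : K) ⊗ₜ[k] x, t⁆) =
        ⁅x, TensorProduct.lid k g (φ.rTensor g t)⁆ := fun x t => by
      induction t with
      | zero => simp
      | add s t hs ht => simp only [lie_add, map_add, hs, ht]
      | tmul a y => simp [LieAlgebra.ExtendScalars.bracket_tmul]
    refine LieAlgebra.IsSimple.exists_eq_smul Aφ fun x y => ?_
    change TensorProduct.lid k g (φ.rTensor g (A (1 ⊗ₜ ⁅x, y⁆))) =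
      ⁅x, TensorProduct.lid k g (φ.rTensor g (A (1 ⊗ₜ y)))⁆
    rw [← hlie, ← hA, LieAlgebra.ExtendScalars.bracket_tmul, one_mul]
  choose c hc using hφ
  have hcoef : ∀ (φ : Module.Dual k K) (i j), φ (B.repr (A (B i)) j) = c φ * b.repr (b i) j := by
    have hrep : ∀ (φ : Module.Dual k K) (t : K ⊗[k] g) (j), φ (B.repr t j) =
        b.repr (TensorProduct.lid k g (φ.rTensor g t)) j := fun φ t j => by
      induction t with
      | zero => simp
      | add s t hs ht => simp only [map_add, Finsupp.add_apply, hs, ht]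
      | tmul a y =>
        have h : ∀ c : k, φ (a * algebraMap k K c) = φ a * c := fun c => by
          rw [mul_comm, ← Algebra.smul_def, map_smul, smul_eq_mul, mul_comm]
        simp [B, h]
    intro φ i j
    rw [hrep, Algebra.TensorProduct.basis_apply, hc, map_smul, Finsupp.smul_apply, smul_eq_mul]
  have hdiag : ∀ i i' : Fin (Module.finrank k g),
      B.repr (A (B i)) i = B.repr (A (B i')) i' := fun i i' => by
    rw [← sub_eq_zero, ← Module.forall_dual_apply_eq_zero_iff k]
    intro φ
    rw [map_sub, hcoef, hcoef]
    simp
  have hoff : ∀ i j, i ≠ j → B.repr (A (B i)) j = 0 := fun i j hij => by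
    rw [← Module.forall_dual_apply_eq_zero_iff k]
    intro φ
    rw [hcoef]
    simp [hij]
  have hc' : ∃ c : K, ∀ i, B.repr (A (B i)) i = c := by
    rcases isEmpty_or_nonempty (Fin (Module.finrank k g)) with h | ⟨⟨i⟩⟩
    · exact ⟨0, fun i => isEmptyElim i⟩
    · exact ⟨_, fun i' => hdiag i' i⟩
  obtain ⟨c, hc⟩ := hc'
  refine ⟨c, fun x => ?_⟩
  have : A = c • LinearMap.id := B.ext fun i => B.ext_elem fun j => by
    rcases eq_or_ne i j with rfl | hij
    · simp [hc]
    · simp [hoff i j hij, hij]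
  simp [this]
-- The three cases for d.
theorem mainTheorem7 {g : Type*} [LieRing g] [LieAlgebra ℂ g] [Module.Finite ℂ g]
    [LieAlgebra.IsSimple ℂ g]
    (δ : LieBialgebraStructure (LaurentSeries ℂ) (LaurentSeries ℂ ⊗[ℂ] g)) :
    -- `A = K[ε]` with `ε² = 0`
    Nonempty (δ.Double ≃ₗ⁅LaurentSeries ℂ⁆
      LieExtend (LaurentSeries ℂ) (DualNumber (LaurentSeries ℂ)) (LaurentSeries ℂ ⊗[ℂ] g)) ∨
    -- `A = K ⊕ K`
    Nonempty (δ.Double ≃ₗ⁅LaurentSeries ℂ⁆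
      LieExtend (LaurentSeries ℂ) (LaurentSeries ℂ × LaurentSeries ℂ)
        (LaurentSeries ℂ ⊗[ℂ] g)) ∨
    -- `A = K[j]` with `j² = ħ`
    Nonempty (δ.Double ≃ₗ⁅LaurentSeries ℂ⁆
      LieExtend (LaurentSeries ℂ)
        (QuadraticAlgebra (LaurentSeries ℂ) (HahnSeries.single (1 : ℤ) (1 : ℂ)) 0)
        (LaurentSeries ℂ ⊗[ℂ] g)) := by
  have : LieAlgebra.IsKilling (LaurentSeries ℂ) (LaurentSeries ℂ ⊗[ℂ] g) :=
    LieAlgebra.isKilling_baseChange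
  obtain ⟨d, ⟨e⟩⟩ := LieBialgebraStructure.Double.exists_lieEquiv_quadraticAlgebra
    LieAlgebra.IsSimple.exists_eq_smul_baseChange δ
  rcases eq_or_ne d 0 with rfl | hd
  · obtain ⟨e'⟩ := nonempty_quadraticAlgebra_zero_algEquiv_dualNumber (K := LaurentSeries ℂ)
    exact Or.inl ⟨e.trans (LieExtend.congr e')⟩
  obtain ⟨s, hs, rfl | rfl⟩ := LaurentSeries.exists_eq_mul_self_or d hd
  · obtain ⟨e'⟩ := nonempty_quadraticAlgebra_sq_algEquiv_prod hs
    exact Or.inr (Or.inl ⟨e.trans (LieExtend.congr e')⟩)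
  · obtain ⟨e'⟩ := nonempty_quadraticAlgebra_mul_sq_algEquiv hs
      (HahnSeries.single (1 : ℤ) (1 : ℂ))
    exact Or.inr (Or.inr ⟨e.trans (LieExtend.congr e')⟩)
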